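/- Consider cache-aided multiuser private information retrieval (MuPIR) with $K=2$ messages of $L$ uniform independent bits each, $K_u\ge 2$ users and $N\ge 2$ non-colluding databases. Each user has a cache of at most $ML$ bits that is a function of the messages, chosen without knowledge of the demands; the caching rule is known to all. For each demand vector $\theta\in[2]^{K_u}$ the users jointly draw queries $Q_1^{[\theta]},\dots,Q_N^{[\theta]}$ (from finite alphabets) independently of the messages, and database $n$ broadcasts an answer $A_n^{[\theta]}$ that is a deterministic function of $Q_n^{[\theta]}$ and the messages $W_1,W_2$. With $Z_u$ the cache of user $u$, a scheme must satisfy decodability, $H(W_{\theta_u}\mid Q^{[\theta]}_{1:N},A^{[\theta]}_{1:N},Z_u)=0$ for all $u$ and $\theta$, and privacy, $I(\theta;Q^{[\theta]}_n,A^{[\theta]}_n,W_{1:2},Z_{1:K_u})=0$ for all $n$ and every law of $\theta$. Its load is $\sum_{n=1}^N H(A_n^{[\theta]})/L$ (in bits), which by privacy does not depend on $\theta$. Let $R^\star(M)$ be the infimum of the loads of all such schemes (over all $L\ge 1$), and $R^\star_{\rm unc}(M)\ge R^\star(M)$ the infimum over the schemes with uncoded prefetching, i.e. those in which every cached bit is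 a copy of a message bit. For $M\in[0,2]$ let $R(M)$ be the value at $M$ of the lower convex envelope of the points $(0,2)$, $(2,0)$ and $(M_t,R_t)$, $1\le t\le K_u-1$, where $$M_t=\frac{2\binom{K_u-1}{t-1}(N-1)}{\binom{K_u}{t}(N-1)+\binom{K_u}{t+1}},\qquad R_t=\min\left\{\frac{\binom{K_u}{t+1}(N+1)}{\binom{K_u}{t}(N-1)+\binom{K_u}{t+1}},\,2-M_t\right\},$$ and let $R^{\rm PD}(M)$, the load of the product design, be the value at $M$ of the lower convex envelope of the points $(0,2)$ and $\left(\frac{2t}{K_u},\ \min\left\{\frac{K_u-t}{t+1}\left(1+\frac1N\right),\,2-\frac{2t}{K_u}\right\}\right)$, $1\le t\le K_u$. Then for every $M\in[0,2]$: $$R(M)\le R^{\rm PD}(M),$$ and $R(M)$ is within a factor of $8$ of the optimal load, both over all cache placements and under uncoded prefetching: $$R^\star(M)\le R(M)\le 8\,R^\star(M),\qquad R^\star_{\rm unc}(M)\le R(M)\le 8\,R^\star_{\rm unc}(M).$$ -/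

import Mathlib

noncomputable section

namespace MuPIR

/-! ### Shannon information measures (in bits) on finite alphabets -/

/-- Shannon entropy, in bits, of a law on a finite alphabet. -/
def entropy {α : Type} [Fintype α] (p : PMF α) : ℝ :=
  (∑ a, Real.negMulLog (p a).toReal) / Real.log 2

/-- Conditional entropy `H(X | Y) = H(X, Y) - H(Y)` of random variables on a discrete space. -/
def condEntropy {Ω α β : Type} [Fintype α] [Fintype β] (p : PMF Ω) (X : Ω → α) (Y : Ω → β) : ℝ :=
  entropy (p.map fun ω => (X ω, Y ω)) - entropy (p.map Y)

/-- Mutual information `I(X; Y) = H(X) + H(Y) - H(X, Y)` of random variables on a discrete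
space. -/
def mutualInfo {Ω α β : Type} [Fintype α] [Fintype β] (p : PMF Ω) (X : Ω → α) (Y : Ω → β) : ℝ :=
  entropy (p.map X) + entropy (p.map Y) - entropy (p.map fun ω => (X ω, Y ω))

/-! ### The cache-aided multiuser PIR problem -/

/-- A library: `K` messages of `L` bits each. -/
abbrev Library (K L : ℕ) : Type := Fin K → Fin L → Bool

/-- A demand vector: the index of the message wanted by each of the `Ku` users. -/
abbrev Demand (K Ku : ℕ) : Type := Fin Ku → Fin K

/-- The placement, query and answer rules of a MuPIR system with `K` messages of `L` bits, `Ku`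
users and `N` databases. The placement ignores the demands. For each demand vector the users
jointly draw the `N` queries, independently of the messages; the answer of a database is a
deterministic function of its query and of the library. -/
structure Scheme (K Ku N L : ℕ) where
  /-- number of bits stored by each user -/
  cacheBits : Fin Ku → ℕ
  /-- cache content of each user -/
  cache : (u : Fin Ku) → Library K L → (Fin (cacheBits u) → Bool)
  /-- query alphabet of each database -/
  Query : Fin N → Type
  [queryFintype : ∀ n, Fintype (Query n)]
  /-- joint law of the `N` queries, for each demand vector -/
  queryLaw : Demand K Ku → PMF (∀ n, Query n)
  /-- answer alphabet of each database -/
  Answer : Fin N → Type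
  [answerFintype : ∀ n, Fintype (Answer n)]
  /-- answer of each database -/
  answer : (n : Fin N) → Query n → Library K L → Answer n

attribute [instance] Scheme.queryFintype Scheme.answerFintype

namespace Scheme

variable {K Ku N L : ℕ} (S : Scheme K Ku N L)

/-- All the queries together. -/
abbrev Queries : Type := ∀ n, S.Query n

/-- All the answers `A_1, …, A_N`, for given library and queries. -/
def answers (W : Library K L) (q : S.Queries) : ∀ n, S.Answer n := fun n => S.answer n (q n) W

/-- All the caches `Z_1, …, Z_Ku`, for a given library. -/
def caches (W : Library K L) : ∀ u, Fin (S.cacheBits u) → Bool := fun u => S.cache u W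

/-- The joint law of the library and the queries for the demand vector `θ`: the library is uniform
and independent of the queries. -/
def law (θ : Demand K Ku) : PMF (Library K L × S.Queries) :=
  (PMF.uniformOfFintype (Library K L)).bind fun W => (S.queryLaw θ).map fun q => (W, q)

/-- The joint law of demands, library and queries when the demand vector is drawn from `π`. -/
def lawWithPrior (π : PMF (Demand K Ku)) : PMF (Demand K Ku × Library K L × S.Queries) :=
  π.bind fun θ => (S.law θ).map fun x => (θ, x)

/-- Decodability: `H(W_{θ_u} | Q_{1:N}, A_{1:N}, Z_u) = 0` for every user `u` and every demand
vector `θ`. -/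
def Decodable : Prop :=
  ∀ (θ : Demand K Ku) (u : Fin Ku),
    condEntropy (S.law θ) (fun x => x.1 (θ u))
      (fun x => (x.2, S.answers x.1 x.2, S.cache u x.1)) = 0

/-- User demand privacy: `I(θ; Q_n, A_n, W_{1:K}, Z_{1:Ku}) = 0` for every database `n`, whatever
the law of the demand vector. -/
def IsPrivate : Prop :=
  ∀ (π : PMF (Demand K Ku)) (n : Fin N),
    mutualInfo (S.lawWithPrior π) (fun x => x.1)
      (fun x => (x.2.2 n, S.answers x.2.1 x.2.2 n, x.2.1, S.caches x.2.1)) = 0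

/-- Uncoded prefetching: each cached bit is a copy of a bit of the library. -/
def IsUncoded : Prop :=
  ∀ u : Fin Ku, ∃ sel : Fin (S.cacheBits u) → Fin K × Fin L,
    ∀ (W : Library K L) (i : Fin (S.cacheBits u)), S.cache u W i = W (sel i).1 (sel i).2

/-- The number of downloaded bits `∑ n, H(A_n)` for the demand vector `θ`. -/
def download (θ : Demand K Ku) : ℝ :=
  ∑ n, entropy ((S.law θ).map fun x => S.answers x.1 x.2 n)

/-- The scheme is a valid MuPIR scheme with memory at most `M * L` bits per user and load at most
`R`. -/
def Attains (M R : ℝ) : Prop :=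
  S.Decodable ∧ S.IsPrivate ∧ (∀ u, (S.cacheBits u : ℝ) ≤ M * L) ∧ ∀ θ, S.download θ ≤ R * L

end Scheme

/-- Achievability of the memory-load pair `(M, R)` with an arbitrary cache placement. -/
def Achievable (K Ku N : ℕ) (M R : ℝ) : Prop :=
  ∃ L : ℕ, 0 < L ∧ ∃ S : Scheme K Ku N L, S.Attains M R

/-- Achievability of the memory-load pair `(M, R)` with uncoded prefetching. -/
def AchievableUncoded (K Ku N : ℕ) (M R : ℝ) : Prop :=
  ∃ L : ℕ, 0 < L ∧ ∃ S : Scheme K Ku N L, S.IsUncoded ∧ S.Attains M R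

/-- The optimal load at memory `M`, over all cache placements. -/
def optimalLoad (K Ku N : ℕ) (M : ℝ) : ℝ := sInf {R : ℝ | Achievable K Ku N M R}

/-- The optimal load at memory `M`, under uncoded prefetching. -/
def optimalLoadUncoded (K Ku N : ℕ) (M : ℝ) : ℝ := sInf {R : ℝ | AchievableUncoded K Ku N M R}

/-! ### The two loads to be compared (two messages) -/

/-- The lower convex envelope, at memory `M`, of a set of memory-load pairs. -/
def lowerConvexEnvelope (P : Set (ℝ × ℝ)) (M : ℝ) : ℝ :=
  sInf {R : ℝ | (M, R) ∈ convexHull ℝ P}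

/-- The message size (in bits) `C(Ku, t) (N - 1) + C(Ku, t + 1)`. -/
def messageSize (Ku N t : ℕ) : ℝ :=
  (Ku.choose t : ℝ) * ((N : ℝ) - 1) + (Ku.choose (t + 1) : ℝ)

/-- The memory `M_t` of the proposed scheme. -/
def proposedMemory (Ku N t : ℕ) : ℝ :=
  2 * ((Ku - 1).choose (t - 1) : ℝ) * ((N : ℝ) - 1) / messageSize Ku N t

/-- The load `R_t` of the proposed scheme. -/
def proposedPointLoad (Ku N t : ℕ) : ℝ :=
  min ((Ku.choose (t + 1) : ℝ) * ((N : ℝ) + 1) / messageSize Ku N t) (2 - proposedMemory Ku N t)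

/-- The load of the proposed scheme: the lower convex envelope of `(0, 2)`, `(2, 0)` and the pairs
`(M_t, R_t)`, `1 ≤ t ≤ Ku - 1`. -/
def proposedLoad (Ku N : ℕ) (M : ℝ) : ℝ :=
  lowerConvexEnvelope
    ({(0, 2), (2, 0)} ∪
      (fun t : ℕ => (proposedMemory Ku N t, proposedPointLoad Ku N t)) '' Set.Icc 1 (Ku - 1)) M

/-- The memory `2 t / Ku` of the product design. -/
def productMemory (Ku t : ℕ) : ℝ := (t : ℝ) * 2 / (Ku : ℝ)

/-- The load of the product design at memory `2 t / Ku`. -/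
def productPointLoad (Ku N t : ℕ) : ℝ :=
  min (((Ku : ℝ) - t) / ((t : ℝ) + 1) * (1 + 1 / (N : ℝ))) (2 - productMemory Ku t)

/-- The load of the product design: the lower convex envelope of `(0, 2)` and its memory-load pairs
for `1 ≤ t ≤ Ku`. -/
def productDesignLoad (Ku N : ℕ) (M : ℝ) : ℝ :=
  lowerConvexEnvelope
    ({(0, 2)} ∪ (fun t : ℕ => (productMemory Ku t, productPointLoad Ku N t)) '' Set.Icc 1 Ku) M

end MuPIR

end

/-!
The proof has three independent parts.

*Converse.* Already a single user who is served once with a demand for each message recovers the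
whole library from one cache and two families of answers, so `2 L ≤ M L + 2 R L`, that is
`R ≥ 1 - M / 2` (`Scheme.load_ge`). Time sharing between `(0, 2)` and `(2, 0)` has load
`2 - M = 2 (1 - M / 2)`, so that with two messages the proposed load is even within a factor `2` of
the optimum (`sInf_load_bounds`). The load counts unconditional answer entropies, and the converse
is obtained from one application of Gibbs' inequality: for fixed queries the uniform law of the
library is compared with the product of the unconditional answer laws and of a uniform cache
(`Scheme.two_mul_le_answerInfo`), and then the queries are averaged.

*Achievability.* The pair `(M_t, R_t)` is reached with one bit per symbol (`Design.exists_align`).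
A message has `N - 1` symbols `W_k[T, i]` for each set `T` of `t` users, cached by the members of
`T`, and one uncached symbol `W_k[S]` for each set `S` of `t + 1` users. With a uniform key `r`,
database `n` gets the query `q_n` that differs from `r` exactly in the `i`-th coefficients of the
wanted messages, `n = i + 1`; each query alone is uniform, hence private. For each `S` and `k` put
`P_k(q) = W_k[S] + ∑ v ∈ S, ∑ i, q v k i * W_k[S \ v, i]`. Database `0` sends `P_0` and `P_1`, the
others send `P_0 + P_1`, which makes `N + 1` bits per set `S`. A user `u ∈ S` knows every term with
`v ≠ u`, and sees the same unwanted combination in all databases: the sum of the answers of the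
databases `i + 1` and `0` is `W_k[S \ u, i]` for the wanted `k`. Knowing these for all `S ∋ u`, the
user gets the uncached symbols from database `0` (`Design.align_decode`). Convex combinations are
reached by carrying out designs side by side (`convex_designRegion`).

*Product design.* Put `r = (Ku - t) / (t + 1)`. Then
`M_t = (2 t / Ku) (N - 1) / (N - 1 + r)` and `R_t ≤ r (N + 1) / (N - 1 + r)`, and the point
`(2 t / Ku, r (1 + 1 / N))` of the product design lies above the segment from `(M_t, R_t)` to
`(2, 0)` because `r + t / Ku ≥ 1` (`productPoint_mem_upperHull`).
-/

namespace MuPIR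

/-! ### Entropy on finite alphabets -/

section Entropy

variable {Ω α β : Type}

lemma sum_map_toReal_mul [Fintype Ω] [Fintype α] (p : PMF Ω) (X : Ω → α) (f : α → ℝ) :
    ∑ a, (p.map X a).toReal * f a = ∑ ω, (p ω).toReal * f (X ω) := by
  classical
  have h : ∀ a, (p.map X a).toReal = ∑ ω, if a = X ω then (p ω).toReal else 0 := by
    intro a
    rw [PMF.map_apply, tsum_fintype, ENNReal.toReal_sum]
    · exact Finset.sum_congr rfl fun ω _ => by split_ifs <;> simp
    · intro ω _
      split_ifs
      · exact p.apply_ne_top ω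
      · simp
  simp_rw [h, Finset.sum_mul, ite_mul, zero_mul]
  rw [Finset.sum_comm]
  simp

lemma sum_toReal [Fintype α] (p : PMF α) : ∑ a, (p a).toReal = 1 := by
  rw [← ENNReal.toReal_sum fun a _ => p.apply_ne_top a, ← tsum_fintype (L := .unconditional _),
    p.tsum_coe, ENNReal.toReal_one]

lemma toReal_map_apply [Fintype Ω] [Fintype α] [DecidableEq α] (p : PMF Ω) (X : Ω → α) (a : α) :
    (p.map X a).toReal = ∑ ω, if X ω = a then (p ω).toReal else 0 := by
  have h := sum_map_toReal_mul p X fun b => if b = a then 1 else 0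
  simpa using h

lemma le_toReal_map_apply [Fintype Ω] [Fintype α] (p : PMF Ω) (X : Ω → α) (ω : Ω) :
    (p ω).toReal ≤ (p.map X (X ω)).toReal := by
  classical
  rw [toReal_map_apply]
  refine le_trans (by simp)
    (Finset.single_le_sum (f := fun ω' => if X ω' = X ω then (p ω').toReal else 0)
      (fun ω' _ => ?_) (Finset.mem_univ ω))
  split_ifs <;> simp

/-- Entropy is the expected self-information, computed on the underlying probability space. -/
lemma entropy_map [Fintype Ω] [Fintype α] (p : PMF Ω) (X : Ω → α) :
    entropy (p.map X) * Real.log 2 =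
      -∑ ω, (p ω).toReal * Real.log (p.map X (X ω)).toReal := by
  rw [entropy, div_mul_cancel₀ _ (Real.log_pos one_lt_two).ne',
    ← sum_map_toReal_mul p X fun a => Real.log (p.map X a).toReal]
  simp [Real.negMulLog]

/-- Gibbs' inequality: the cross entropy with respect to a sub-probability `q` dominates the
entropy. -/
lemma entropy_le_cross [Fintype α] (p : PMF α) (q : α → ℝ) (hq : ∀ a, 0 ≤ q a)
    (hsum : ∑ a, q a ≤ 1) (hpos : ∀ a, p a ≠ 0 → 0 < q a) :
    entropy p * Real.log 2 ≤ -∑ a, (p a).toReal * Real.log (q a) := by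
  rw [entropy, div_mul_cancel₀ _ (Real.log_pos one_lt_two).ne', ← Finset.sum_neg_distrib]
  have key : ∀ a, Real.negMulLog (p a).toReal ≤
      -((p a).toReal * Real.log (q a)) + (q a - (p a).toReal) := by
    intro a
    by_cases h : p a = 0
    · simp [h, hq a]
    · have hp : 0 < (p a).toReal := ENNReal.toReal_pos h (p.apply_ne_top a)
      have hl := Real.log_le_sub_one_of_pos (div_pos (hpos a h) hp)
      rw [Real.log_div (hpos a h).ne' hp.ne'] at hl
      have := mul_le_mul_of_nonneg_left hl hp.le
      rw [mul_sub, mul_sub, mul_div_cancel₀ _ hp.ne'] at this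
      rw [Real.negMulLog]
      linarith
  refine (Finset.sum_le_sum fun a _ => key a).trans ?_
  rw [Finset.sum_add_distrib, Finset.sum_sub_distrib, sum_toReal]
  linarith

lemma entropy_le_logb_card [Fintype α] (p : PMF α) (b : ℕ) (hb : Fintype.card α = 2 ^ b) :
    entropy p ≤ b := by
  have h := entropy_le_cross p (fun _ => ((2 : ℝ) ^ b)⁻¹) (fun _ => by positivity)
    (by simp [hb]) (fun _ _ => by positivity)
  rw [← Finset.sum_mul, sum_toReal, Real.log_inv, Real.log_pow] at h
  have := Real.log_pos one_lt_two
  nlinarith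

lemma entropy_uniformOfFintype [Fintype α] [Nonempty α] (b : ℕ) (hb : Fintype.card α = 2 ^ b) :
    entropy (PMF.uniformOfFintype α) = b := by
  have h2 := (Real.log_pos one_lt_two).ne'
  simp only [entropy, PMF.uniformOfFintype_apply, hb, Real.negMulLog]
  simp [hb]
  field_simp

/-- A vanishing conditional entropy means that `Y` determines `X` on the support. -/
lemma condEntropy_eq_zero_iff [Fintype Ω] [Fintype α] [Fintype β] (p : PMF Ω) (X : Ω → α)
    (Y : Ω → β) :
    condEntropy p X Y = 0 ↔ ∀ ω ω', p ω ≠ 0 → p ω' ≠ 0 → Y ω = Y ω' → X ω = X ω' := by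
  classical
  have h2 := Real.log_pos one_lt_two
  have hmul : condEntropy p X Y * Real.log 2 =
      ∑ ω, (p ω).toReal * (Real.log (p.map Y (Y ω)).toReal -
        Real.log (p.map (fun ω => (X ω, Y ω)) (X ω, Y ω)).toReal) := by
    rw [condEntropy, sub_mul, entropy_map, entropy_map]
    simp only [mul_sub, Finset.sum_sub_distrib]
    ring
  have hle : ∀ ω, (p.map (fun ω => (X ω, Y ω)) (X ω, Y ω)).toReal ≤ (p.map Y (Y ω)).toReal := by
    intro ω
    rw [toReal_map_apply, toReal_map_apply]
    refine Finset.sum_le_sum fun ω' _ => ?_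
    simp only [Prod.mk.injEq]
    split_ifs <;> simp_all
  have hpos : ∀ ω, p ω ≠ 0 → 0 < (p.map (fun ω => (X ω, Y ω)) (X ω, Y ω)).toReal := fun ω hω =>
    (ENNReal.toReal_pos hω (p.apply_ne_top ω)).trans_le
      (le_toReal_map_apply p (fun ω => (X ω, Y ω)) ω)
  -- The conditional entropy is a sum of nonnegative terms.
  have hterm : ∀ ω, 0 ≤ (p ω).toReal * (Real.log (p.map Y (Y ω)).toReal -
        Real.log (p.map (fun ω => (X ω, Y ω)) (X ω, Y ω)).toReal) := by
    intro ω
    by_cases hω : p ω = 0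
    · simp [hω]
    · exact mul_nonneg ENNReal.toReal_nonneg (sub_nonneg.2 (Real.log_le_log (hpos ω hω) (hle ω)))
  have hiff : condEntropy p X Y = 0 ↔ ∀ ω, p ω ≠ 0 →
      (p.map Y (Y ω)).toReal = (p.map (fun ω => (X ω, Y ω)) (X ω, Y ω)).toReal := by
    rw [← mul_eq_zero_iff_right h2.ne', hmul, Finset.sum_eq_zero_iff_of_nonneg fun ω _ => hterm ω]
    refine ⟨fun h ω hω => ?_, fun h ω _ => ?_⟩
    · have h1 := (mul_eq_zero.1 (h ω (Finset.mem_univ ω))).resolve_left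
        (ENNReal.toReal_pos hω (p.apply_ne_top ω)).ne'
      exact Real.log_injOn_pos ((hpos ω hω).trans_le (hle ω)) (hpos ω hω) (sub_eq_zero.1 h1)
    · by_cases hω : p ω = 0
      · simp [hω]
      · rw [h ω hω, sub_self, mul_zero]
  rw [hiff]
  -- `P(Y = y) - P(X = x, Y = y)` is the mass of the outcomes with the same `Y` and another `X`.
  have hdiff : ∀ ω, (p.map Y (Y ω)).toReal - (p.map (fun ω => (X ω, Y ω)) (X ω, Y ω)).toReal =
      ∑ ω', if Y ω' = Y ω ∧ X ω' ≠ X ω then (p ω').toReal else 0 := by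
    intro ω
    rw [toReal_map_apply, toReal_map_apply, ← Finset.sum_sub_distrib]
    refine Finset.sum_congr rfl fun ω' _ => ?_
    simp only [Prod.mk.injEq]
    split_ifs <;> simp_all
  refine ⟨fun h ω ω' hω hω' hY => ?_, fun h ω hω => ?_⟩
  · by_contra hX
    have h0 := hdiff ω
    rw [h ω hω, sub_self, eq_comm, Finset.sum_eq_zero_iff_of_nonneg
      fun _ _ => by split_ifs <;> simp] at h0
    have h1 := h0 ω' (Finset.mem_univ _)
    rw [if_pos ⟨hY.symm, Ne.symm hX⟩] at h1
    exact (ENNReal.toReal_pos hω' (p.apply_ne_top ω')).ne' h1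
  · rw [← sub_eq_zero, hdiff]
    refine Finset.sum_eq_zero fun ω' _ => ?_
    split_ifs with hc
    · by_contra hne
      exact hc.2 (h ω' ω (fun h0 => hne (by simp [h0])) hω hc.1)
    · rfl

lemma bind_map_pair_apply (π : PMF α) (r : PMF β) (a : α) (b : β) :
    (π.bind fun a => r.map fun b => (a, b)) (a, b) = π a * r b := by
  classical
  rw [PMF.bind_apply, tsum_eq_single a, PMF.map_apply, tsum_eq_single b]
  · simp
  · intro b' hb'
    simp [hb'.symm]
  · intro a' ha'
    simp [PMF.map_apply, ha'.symm]

/-- The mutual information vanishes if `(X, Y)` is distributed as an independent pair. -/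
lemma mutualInfo_eq_zero [Fintype Ω] [Fintype α] [Fintype β] (p : PMF Ω) (X : Ω → α)
    (Y : Ω → β) (π : PMF α) (r : PMF β)
    (h : p.map (fun ω => (X ω, Y ω)) = π.bind fun a => r.map fun b => (a, b)) :
    mutualInfo p X Y = 0 := by
  classical
  have hX : p.map X = π := by
    have := congrArg (PMF.map Prod.fst) h
    rw [PMF.map_comp, PMF.map_bind] at this
    simp only [PMF.map_comp] at this
    refine this.trans ?_
    change (π.bind fun a => r.map (Function.const β a)) = π
    simp only [PMF.map_const, PMF.bind_pure]
  have hY : p.map Y = r := by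
    have := congrArg (PMF.map Prod.snd) h
    rw [PMF.map_comp, PMF.map_bind] at this
    simp only [PMF.map_comp] at this
    refine this.trans ?_
    change (π.bind fun _ => r.map id) = r
    rw [PMF.map_id, PMF.bind_const]
  have hXY : ∀ a b, (p.map (fun ω => (X ω, Y ω)) (a, b)).toReal =
      (p.map X a).toReal * (p.map Y b).toReal := by
    intro a b
    rw [h, hX, hY, bind_map_pair_apply, ENNReal.toReal_mul]
  have h2 := (Real.log_pos one_lt_two).ne'
  rw [← mul_eq_zero_iff_right h2, mutualInfo, sub_mul, add_mul, entropy_map, entropy_map,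
    entropy_map]
  simp only [hXY]
  rw [← neg_add, ← Finset.sum_add_distrib, sub_neg_eq_add, neg_add_eq_zero]
  refine Finset.sum_congr rfl fun ω _ => ?_
  by_cases hω : p ω = 0
  · simp [hω]
  · have h0 := ENNReal.toReal_pos hω (p.apply_ne_top ω)
    rw [Real.log_mul (h0.trans_le (le_toReal_map_apply p X ω)).ne'
      (h0.trans_le (le_toReal_map_apply p Y ω)).ne', mul_add]

end Entropy

/-! ### The converse bound `R ≥ 1 - M / 2` -/

lemma le_sum_toReal_mul {α : Type} [Fintype α] (p : PMF α) (f : α → ℝ) (c : ℝ)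
    (h : ∀ a, p a ≠ 0 → c ≤ f a) : c ≤ ∑ a, (p a).toReal * f a := by
  have h1 : c = ∑ a, (p a).toReal * c := by rw [← Finset.sum_mul, sum_toReal, one_mul]
  rw [h1]
  refine Finset.sum_le_sum fun a _ => ?_
  by_cases ha : p a = 0
  · simp [ha]
  · exact mul_le_mul_of_nonneg_left (h a ha) ENNReal.toReal_nonneg

namespace Scheme

variable {K Ku N L : ℕ} (S : Scheme K Ku N L)

lemma law_apply (θ : Demand K Ku) (W : Library K L) (q : S.Queries) :
    S.law θ (W, q) = PMF.uniformOfFintype (Library K L) W * S.queryLaw θ q :=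
  bind_map_pair_apply _ _ _ _

lemma law_ne_zero {θ : Demand K Ku} (W : Library K L) {q : S.Queries} (hq : S.queryLaw θ q ≠ 0) :
    S.law θ (W, q) ≠ 0 := by
  rw [law_apply]
  exact mul_ne_zero (by simp) hq

/-- The probability that database `n` answers `a`, averaged over the queries. -/
noncomputable def answerProb (θ : Demand K Ku) (n : Fin N) (a : S.Answer n) : ℝ :=
  ((S.law θ).map (fun x => S.answers x.1 x.2 n) a).toReal

lemma answerProb_pos {θ : Demand K Ku} (n : Fin N) (W : Library K L) {q : S.Queries}
    (hq : S.queryLaw θ q ≠ 0) : 0 < S.answerProb θ n (S.answer n (q n) W) :=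
  (ENNReal.toReal_pos (S.law_ne_zero W hq) ((S.law θ).apply_ne_top _)).trans_le
    (le_toReal_map_apply (S.law θ) (fun x => S.answers x.1 x.2 n) (W, q))

lemma sum_prod_answerProb (θ : Demand K Ku) :
    ∑ a : ∀ n, S.Answer n, ∏ n, S.answerProb θ n (a n) = 1 := by
  classical
  rw [← Fintype.piFinset_univ, ← Finset.prod_univ_sum]
  exact Finset.prod_eq_one fun n _ => sum_toReal _

/-- The self-information of the answers to the queries `q`, with respect to the unconditional laws
of the answers, averaged over the library. Its mean over `q` is the download. -/
noncomputable def answerInfo (θ : Demand K Ku) (q : S.Queries) : ℝ :=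
  -∑ W, (PMF.uniformOfFintype (Library K L) W).toReal *
    ∑ n, Real.log (S.answerProb θ n (S.answer n (q n) W))

lemma sum_queryLaw_mul_answerInfo (θ : Demand K Ku) :
    ∑ q, (S.queryLaw θ q).toReal * S.answerInfo θ q = S.download θ * Real.log 2 := by
  rw [download, Finset.sum_mul]
  simp only [entropy_map, Fintype.sum_prod_type, law_apply, ENNReal.toReal_mul, answerInfo,
    mul_neg, Finset.mul_sum, Finset.sum_neg_distrib]
  congr 1
  rw [Finset.sum_comm]
  conv_rhs => rw [Finset.sum_comm]
  refine Finset.sum_congr rfl fun W _ => ?_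
  conv_rhs => rw [Finset.sum_comm]
  refine Finset.sum_congr rfl fun q _ => Finset.sum_congr rfl fun n _ => ?_
  rw [← mul_assoc, mul_comm (S.queryLaw θ q).toReal]
  rfl

/-- For fixed queries, a cache and two families of answers that together determine the library
carry at least `2 L` bits. -/
lemma two_mul_le_answerInfo (S : Scheme 2 Ku N L) (θ θ' : Demand 2 Ku) (u : Fin Ku)
    (q q' : S.Queries) (hq : S.queryLaw θ q ≠ 0) (hq' : S.queryLaw θ' q' ≠ 0)
    (hinj : Function.Injective fun W => (S.cache u W, S.answers W q, S.answers W q')) :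
    2 * (L : ℝ) * Real.log 2 ≤
      S.cacheBits u * Real.log 2 + S.answerInfo θ q + S.answerInfo θ' q' := by
  classical
  -- The sub-probability `G ∘ F` on libraries to which the uniform law is compared.
  let G : (Fin (S.cacheBits u) → Bool) × (∀ n, S.Answer n) × (∀ n, S.Answer n) → ℝ := fun x =>
    ((2 : ℝ) ^ S.cacheBits u)⁻¹ *
      ((∏ n, S.answerProb θ n (x.2.1 n)) * ∏ n, S.answerProb θ' n (x.2.2 n))
  let F := fun W => (S.cache u W, S.answers W q, S.answers W q')
  have hG0 : ∀ x, 0 ≤ G x := fun x => mul_nonneg (by positivity) (mul_nonneg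
    (Finset.prod_nonneg fun _ _ => ENNReal.toReal_nonneg)
    (Finset.prod_nonneg fun _ _ => ENNReal.toReal_nonneg))
  have hG1 : ∑ x, G x = 1 := by
    simp only [G, Fintype.sum_prod_type, ← Finset.mul_sum, ← Finset.sum_mul, sum_prod_answerProb]
    simp
  have hFG : ∑ W, G (F W) ≤ 1 := by
    rw [← hG1, ← Finset.sum_image (f := G) (g := F) fun _ _ _ _ h => hinj h]
    exact Finset.sum_le_univ_sum_of_nonneg hG0
  have hp : ∀ W n, 0 < S.answerProb θ n (S.answer n (q n) W) := fun W n => S.answerProb_pos n W hq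
  have hp' : ∀ W n, 0 < S.answerProb θ' n (S.answer n (q' n) W) :=
    fun W n => S.answerProb_pos n W hq'
  have hlog : ∀ W, Real.log (G (F W)) = -(S.cacheBits u * Real.log 2) +
      (∑ n, Real.log (S.answerProb θ n (S.answer n (q n) W)) +
        ∑ n, Real.log (S.answerProb θ' n (S.answer n (q' n) W))) := by
    intro W
    rw [← Real.log_prod fun n _ => (hp W n).ne', ← Real.log_prod fun n _ => (hp' W n).ne',
      ← Real.log_pow, ← Real.log_inv, ← Real.log_mul
        (Finset.prod_pos fun n _ => hp W n).ne' (Finset.prod_pos fun n _ => hp' W n).ne',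
      ← Real.log_mul (by positivity) (mul_pos (Finset.prod_pos fun n _ => hp W n)
        (Finset.prod_pos fun n _ => hp' W n)).ne']
    rfl
  have hgibbs := entropy_le_cross (PMF.uniformOfFintype (Library 2 L)) (fun W => G (F W))
    (fun W => hG0 _) hFG fun W _ => mul_pos (by positivity)
      (mul_pos (Finset.prod_pos fun n _ => hp W n) (Finset.prod_pos fun n _ => hp' W n))
  rw [entropy_uniformOfFintype (2 * L) (by simp [pow_mul, mul_comm 2 L])] at hgibbs
  simp only [hlog, mul_add, Finset.sum_add_distrib, ← Finset.sum_mul, sum_toReal] at hgibbs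
  simp only [answerInfo]
  push_cast at hgibbs
  linarith

/-- One user who sees the answers for a demand of each message recovers both messages, so that
`2 L ≤ M L + 2 R L`. -/
theorem load_ge (S : Scheme 2 Ku N L) (hKu : 0 < Ku) (hL : 0 < L) {M R : ℝ}
    (hS : S.Attains M R) : 1 - M / 2 ≤ R := by
  obtain ⟨hdec, -, hmem, hload⟩ := hS
  let u : Fin Ku := ⟨0, hKu⟩
  let θ : Fin 2 → Demand 2 Ku := fun k _ => k
  have hinj : ∀ q q', S.queryLaw (θ 0) q ≠ 0 → S.queryLaw (θ 1) q' ≠ 0 →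
      Function.Injective fun W => (S.cache u W, S.answers W q, S.answers W q') := by
    intro q q' hq hq' W W' h
    simp only [Prod.mk.injEq] at h
    obtain ⟨hz, ha, ha'⟩ := h
    have h0 := (condEntropy_eq_zero_iff _ _ _).1 (hdec (θ 0) u) (W, q) (W', q)
      (S.law_ne_zero W hq) (S.law_ne_zero W' hq) (by simp [hz, ha])
    have h1 := (condEntropy_eq_zero_iff _ _ _).1 (hdec (θ 1) u) (W, q') (W', q')
      (S.law_ne_zero W hq') (S.law_ne_zero W' hq') (by simp [hz, ha'])
    funext k
    fin_cases k
    exacts [h0, h1]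
  -- The two families of queries are averaged one after the other.
  have h1 : ∀ q, S.queryLaw (θ 0) q ≠ 0 →
      2 * (L : ℝ) * Real.log 2 - S.cacheBits u * Real.log 2 - S.download (θ 1) * Real.log 2 ≤
        S.answerInfo (θ 0) q := by
    intro q hq
    have := le_sum_toReal_mul (S.queryLaw (θ 1)) (S.answerInfo (θ 1))
      (2 * (L : ℝ) * Real.log 2 - S.cacheBits u * Real.log 2 - S.answerInfo (θ 0) q)
      fun q' hq' => by
        linarith [S.two_mul_le_answerInfo (θ 0) (θ 1) u q q' hq hq' (hinj q q' hq hq')]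
    rw [sum_queryLaw_mul_answerInfo] at this
    linarith
  have h2 := le_sum_toReal_mul _ _ _ h1
  rw [sum_queryLaw_mul_answerInfo] at h2
  have h3 : 2 * (L : ℝ) ≤ S.cacheBits u + S.download (θ 0) + S.download (θ 1) :=
    le_of_mul_le_mul_right (by linarith) (Real.log_pos one_lt_two)
  have hL' : (0 : ℝ) < L := by exact_mod_cast hL
  refine le_of_mul_le_mul_right ?_ hL'
  linarith [hmem u, hload (θ 0), hload (θ 1)]

/-! ### Sufficient conditions for decodability and privacy -/

lemma decodable_of_determined
    (h : ∀ (θ : Demand K Ku) (u : Fin Ku) (q : S.Queries) (W W' : Library K L),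
      S.queryLaw θ q ≠ 0 → S.answers W q = S.answers W' q → S.cache u W = S.cache u W' →
      W (θ u) = W' (θ u)) : S.Decodable := by
  intro θ u
  refine (condEntropy_eq_zero_iff _ _ _).2 ?_
  rintro ⟨W, q⟩ ⟨W', q'⟩ hω - hY
  simp only [Prod.mk.injEq] at hY
  obtain ⟨rfl, ha, hz⟩ := hY
  rw [law_apply] at hω
  exact h θ u q W W' (right_ne_zero_of_mul hω) ha hz

/-- A scheme is private as soon as the law of each single query does not depend on the demands. -/
lemma isPrivate_of_queryLaw
    (h : ∀ (θ θ' : Demand K Ku) (n : Fin N),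
      (S.queryLaw θ).map (fun q => q n) = (S.queryLaw θ').map fun q => q n) : S.IsPrivate := by
  intro π n
  obtain ⟨θ₀, -⟩ := π.support_nonempty
  let view : Library K L × S.Queries → S.Query n × S.Answer n × Library K L ×
      (∀ u, Fin (S.cacheBits u) → Bool) :=
    fun x => (x.2 n, S.answers x.1 x.2 n, x.1, S.caches x.1)
  have hview : ∀ θ, (S.law θ).map view = (S.law θ₀).map view := by
    have hfactor : ∀ θ, (S.law θ).map view = (PMF.uniformOfFintype (Library K L)).bind fun W =>
        ((S.queryLaw θ).map fun q => q n).map fun a => (a, S.answer n a W, W, S.caches W) := by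
      intro θ
      rw [law, PMF.map_bind]
      simp only [PMF.map_comp]
      rfl
    intro θ
    rw [hfactor, hfactor, h θ θ₀ n]
  refine mutualInfo_eq_zero _ _ _ π ((S.law θ₀).map view) ?_
  rw [lawWithPrior, PMF.map_bind]
  refine congrArg π.bind (funext fun θ => ?_)
  rw [← hview θ, PMF.map_comp, PMF.map_comp]
  rfl

lemma download_le (θ : Demand K Ku) (b : Fin N → ℕ)
    (hb : ∀ n, Fintype.card (S.Answer n) = 2 ^ b n) : S.download θ ≤ ∑ n, (b n : ℝ) :=
  Finset.sum_le_sum fun n _ => entropy_le_logb_card _ _ (hb n)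

end Scheme

/-! ### Combinatorial designs of schemes -/

/-- The combinatorial data of a scheme with uncoded prefetching, over the field `ZMod 2`: message
positions are indexed by an arbitrary finite type, the queries are a function of the demands and of
a uniform key, and answers are families of bits. Decodability is the absence of collisions;
privacy is expressed by a re-indexing of the keys that turns the query to a given database for one
demand vector into the query for another. -/
structure Design (K Ku N : ℕ) where
  /-- positions of the symbols of a message -/
  Pos : Type
  [posFintype : Fintype Pos]
  /-- positions of message `k` cached by user `u` -/
  cached : Fin Ku → Fin K → Finset Pos
  /-- alphabet of the uniform key shared by the users -/
  Key : Type
  [keyFintype : Fintype Key]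
  [keyNonempty : Nonempty Key]
  /-- query alphabet of each database -/
  Query : Fin N → Type
  [queryFintype : ∀ n, Fintype (Query n)]
  /-- queries for given demands and key -/
  query : Demand K Ku → Key → ∀ n, Query n
  /-- positions of the bits of the answer of each database -/
  Slot : Fin N → Type
  [slotFintype : ∀ n, Fintype (Slot n)]
  /-- answer of each database -/
  answer : ∀ n, Query n → (Fin K → Pos → ZMod 2) → Slot n → ZMod 2
  /-- the wanted message is determined by the cached symbols and the answers -/
  decode : ∀ (θ : Demand K Ku) (u : Fin Ku) (r : Key) (W W' : Fin K → Pos → ZMod 2),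
    (∀ k, ∀ x ∈ cached u k, W k x = W' k x) →
    (∀ n, answer n (query θ r n) W = answer n (query θ r n) W') → W (θ u) = W' (θ u)
  /-- the law of each single query does not depend on the demands -/
  rekey : ∀ (θ θ' : Demand K Ku) (n : Fin N),
    ∃ σ : Equiv.Perm Key, ∀ r, query θ r n = query θ' (σ r) n

attribute [instance] Design.posFintype Design.keyFintype Design.keyNonempty Design.queryFintype
  Design.slotFintype

namespace Design

variable {K Ku N : ℕ}

/-- A design with messages of `L` symbols, in which each user caches at most `m` symbols and at
most `d` symbols are downloaded, exists. -/
def Exists (K Ku N L m d : ℕ) : Prop :=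
  ∃ D : Design K Ku N, Fintype.card D.Pos = L ∧ (∀ u, ∑ k, (D.cached u k).card ≤ m) ∧
    ∑ n, Fintype.card (D.Slot n) ≤ d

/-- The library of a scheme read as symbols of `ZMod 2` on the positions of a design. -/
def readLibrary (D : Design K Ku N) {L : ℕ} (e : D.Pos ≃ Fin L) (W : Library K L) :
    Fin K → D.Pos → ZMod 2 :=
  fun k x => if W k (e x) then 1 else 0

/-- The scheme carried out by a design. -/
noncomputable def toScheme (D : Design K Ku N) {L : ℕ} (e : D.Pos ≃ Fin L) : Scheme K Ku N L where
  cacheBits u := Fintype.card (Σ k, {x // x ∈ D.cached u k})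
  cache u W i := W ((Fintype.equivFin _).symm i).1 (e ((Fintype.equivFin _).symm i).2)
  Query := D.Query
  queryLaw θ := (PMF.uniformOfFintype D.Key).map (D.query θ)
  Answer n := D.Slot n → ZMod 2
  answerFintype := fun n => by classical exact inferInstance
  answer n q W := D.answer n q (D.readLibrary e W)

lemma uniformOfFintype_map_equiv {α : Type} [Fintype α] [Nonempty α] (σ : α ≃ α) :
    (PMF.uniformOfFintype α).map σ = PMF.uniformOfFintype α := by
  classical
  ext a
  rw [PMF.map_apply, tsum_eq_single (σ.symm a)]
  · simp
  · intro b hb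
    rw [if_neg]
    rintro rfl
    simp at hb

lemma Exists.achievableUncoded {L m d : ℕ} (h : Exists K Ku N L m d) (hL : 0 < L) {M R : ℝ}
    (hm : (m : ℝ) ≤ M * L) (hd : (d : ℝ) ≤ R * L) : AchievableUncoded K Ku N M R := by
  obtain ⟨D, hpos, hcache, hslot⟩ := h
  let e : D.Pos ≃ Fin L := Fintype.equivFinOfCardEq hpos
  refine ⟨L, hL, D.toScheme e, fun u => ⟨fun i => (((Fintype.equivFin _).symm i).1,
    e ((Fintype.equivFin _).symm i).2), fun W i => rfl⟩, ?_, ?_, fun u => ?_, fun θ => ?_⟩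
  · refine Scheme.decodable_of_determined _ fun θ u q W W' hq ha hz => ?_
    obtain ⟨r, -, rfl⟩ := (PMF.mem_support_map_iff _ _ _).1 ((PMF.mem_support_iff _ _).2 hq)
    have h0 := D.decode θ u r (D.readLibrary e W) (D.readLibrary e W')
      (fun k x hx => by
        have h1 : ∀ s : Σ k, {x // x ∈ D.cached u k}, W s.1 (e s.2) = W' s.1 (e s.2) :=
          (Fintype.equivFin _).symm.surjective.forall.2 fun i => congrFun hz i
        simp only [readLibrary, h1 ⟨k, x, hx⟩])
      (fun n => congrFun ha n)
    funext i
    have h1 := congrFun h0 (e.symm i)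
    simp only [readLibrary, Equiv.apply_symm_apply] at h1
    revert h1
    cases W (θ u) i <;> cases W' (θ u) i <;> simp
  · refine Scheme.isPrivate_of_queryLaw _ fun θ θ' n => ?_
    obtain ⟨σ, hσ⟩ := D.rekey θ θ' n
    change ((PMF.uniformOfFintype D.Key).map (D.query θ)).map (fun q => q n) =
      ((PMF.uniformOfFintype D.Key).map (D.query θ')).map fun q => q n
    rw [PMF.map_comp, PMF.map_comp]
    conv_rhs => rw [← uniformOfFintype_map_equiv σ, PMF.map_comp]
    exact congrArg (fun f => PMF.map f _) (funext hσ)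
  · refine le_trans ?_ hm
    have : (D.toScheme e).cacheBits u = ∑ k, (D.cached u k).card := by
      simp [toScheme, Fintype.card_sigma]
    exact_mod_cast this ▸ hcache u
  · refine le_trans ?_ hd
    refine (Scheme.download_le _ θ (fun n => Fintype.card (D.Slot n)) fun n => ?_).trans
      (by exact_mod_cast hslot)
    classical
    rw [← ZMod.card 2, ← Fintype.card_fun]
    exact Fintype.card_congr (Equiv.refl _)

/-! ### Concatenation of designs -/

/-- Two designs carried out side by side on disjoint parts of the messages, with independent
keys. -/
def append (D E : Design K Ku N) : Design K Ku N where
  Pos := D.Pos ⊕ E.Pos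
  cached u k := (D.cached u k).disjSum (E.cached u k)
  Key := D.Key × E.Key
  Query n := D.Query n × E.Query n
  query θ r n := (D.query θ r.1 n, E.query θ r.2 n)
  Slot n := D.Slot n ⊕ E.Slot n
  answer n q W := Sum.elim (D.answer n q.1 fun k x => W k (.inl x))
    (E.answer n q.2 fun k x => W k (.inr x))
  decode θ u r W W' hc ha := by
    have h1 := D.decode θ u r.1 (fun k x => W k (.inl x)) (fun k x => W' k (.inl x))
      (fun k x hx => hc k _ (Finset.inl_mem_disjSum.2 hx))
      (fun n => funext fun s => congrFun (ha n) (.inl s))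
    have h2 := E.decode θ u r.2 (fun k x => W k (.inr x)) (fun k x => W' k (.inr x))
      (fun k x hx => hc k _ (Finset.inr_mem_disjSum.2 hx))
      (fun n => funext fun s => congrFun (ha n) (.inr s))
    funext x
    cases x with
    | inl x => exact congrFun h1 x
    | inr x => exact congrFun h2 x
  rekey θ θ' n := by
    obtain ⟨σ, hσ⟩ := D.rekey θ θ' n
    obtain ⟨τ, hτ⟩ := E.rekey θ θ' n
    exact ⟨σ.prodCongr τ, fun r => Prod.ext (hσ r.1) (hτ r.2)⟩

lemma Exists.append {L m d L' m' d' : ℕ} (h : Exists K Ku N L m d)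
    (h' : Exists K Ku N L' m' d') : Exists K Ku N (L + L') (m + m') (d + d') := by
  obtain ⟨D, hL, hm, hd⟩ := h
  obtain ⟨E, hL', hm', hd'⟩ := h'
  refine ⟨D.append E, ?_, fun u => ?_, ?_⟩
  · rw [← hL, ← hL']
    exact Fintype.card_sum
  · refine le_trans (le_of_eq ?_) (add_le_add (hm u) (hm' u))
    rw [← Finset.sum_add_distrib]
    exact Finset.sum_congr rfl fun k _ => Finset.card_disjSum _ _
  · refine le_trans (le_of_eq ?_) (add_le_add hd hd')
    rw [← Finset.sum_add_distrib]
    exact Finset.sum_congr rfl fun n _ => Fintype.card_sum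

/-- The design with empty messages. -/
lemma exists_empty : Exists K Ku N 0 0 0 :=
  ⟨{ Pos := Empty
     cached := fun _ _ => ∅
     Key := Unit
     Query := fun _ => Unit
     query := fun _ _ _ => ()
     Slot := fun _ => Empty
     answer := fun _ _ _ s => s.elim
     decode := fun _ _ _ _ _ _ _ => Subsingleton.elim _ _
     rekey := fun _ _ _ => ⟨1, fun _ => rfl⟩ }, by simp, by simp, by simp⟩

lemma Exists.smul {L m d : ℕ} (h : Exists K Ku N L m d) (j : ℕ) :
    Exists K Ku N (j * L) (j * m) (j * d) := by
  induction j with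
  | zero => simpa using exists_empty
  | succ j ih =>
    simp only [Nat.succ_mul]
    exact ih.append h

/-- Every user caches the whole library. -/
lemma exists_cache_all : Exists K Ku N 1 K 0 :=
  ⟨{ Pos := Unit
     cached := fun _ _ => Finset.univ
     Key := Unit
     Query := fun _ => Unit
     query := fun _ _ _ => ()
     Slot := fun _ => Empty
     answer := fun _ _ _ s => s.elim
     decode := fun θ u _ _ _ hc _ => funext fun x => hc (θ u) x (Finset.mem_univ x)
     rekey := fun _ _ _ => ⟨1, fun _ => rfl⟩ }, by simp, by simp, by simp⟩

/-- The whole library is downloaded from one database. -/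
lemma exists_download_all (hN : 0 < N) : Exists K Ku N 1 0 K :=
  ⟨{ Pos := Unit
     cached := fun _ _ => ∅
     Key := Unit
     Query := fun _ => Unit
     query := fun _ _ _ => ()
     Slot := fun n => {_k : Fin K // n = ⟨0, hN⟩}
     answer := fun _ _ W s => W s.1 ()
     decode := fun θ u _ _ _ _ ha => funext fun _ => congrFun (ha ⟨0, hN⟩) ⟨θ u, rfl⟩
     rekey := fun _ _ _ => ⟨1, fun _ => rfl⟩ }, by simp, by simp, by
      rw [Finset.sum_eq_single ⟨0, hN⟩]
      · simp
      · intro n _ hn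
        simp [hn]
      · simp⟩

end Design

namespace Design

/-! ### The interference-aligning design -/

section Alignment

variable {Ku N t : ℕ}

/-- The sets of `t` users. -/
abbrev UserSet (Ku t : ℕ) : Type := {T : Finset (Fin Ku) // T.card = t}

/-- Positions of a message: `N - 1` symbols for each set of `t` users, which they cache, and one
uncached symbol for each set of `t + 1` users. -/
abbrev AlignPos (Ku N t : ℕ) : Type := (UserSet Ku t × Fin (N - 1)) ⊕ UserSet Ku (t + 1)

/-- The set `S` without its member `v`. -/
def UserSet.erase (S : UserSet Ku (t + 1)) (v : {v // v ∈ S.1}) : UserSet Ku t :=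
  ⟨S.1.erase v, by rw [Finset.card_erase_of_mem v.2, S.2, Nat.add_sub_cancel]⟩

/-- The combination of symbols of message `k` for the set `S` with the coefficients `q`: the
uncached symbol of `S`, plus combinations of the symbols of the sets `S \ {v}`, `v ∈ S`. -/
def alignSum (q : Fin Ku → Fin 2 → Fin (N - 1) → ZMod 2) (W : Fin 2 → AlignPos Ku N t → ZMod 2)
    (S : UserSet Ku (t + 1)) (k : Fin 2) : ZMod 2 :=
  W k (.inr S) + ∑ v : {v // v ∈ S.1}, ∑ i, q v k i * W k (.inl (S.erase v, i))

/-- The query to database `n`: the key, in which, for `n = i + 1` and every user `u`, the `i`-th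
coefficient for the message wanted by `u` is flipped. -/
def alignQuery (θ : Demand 2 Ku) (r : Fin Ku → Fin 2 → Fin (N - 1) → ZMod 2) (n : Fin N) :
    Fin Ku → Fin 2 → Fin (N - 1) → ZMod 2 :=
  r + fun v k i => if k = θ v ∧ n.val = i.val + 1 then 1 else 0

/-- Database `0` answers the combinations of both messages, the others only their sum. -/
def alignAnswer (n : Fin N) (q : Fin Ku → Fin 2 → Fin (N - 1) → ZMod 2)
    (W : Fin 2 → AlignPos Ku N t → ZMod 2)
    (s : UserSet Ku (t + 1) × Fin (if n.val = 0 then 2 else 1)) : ZMod 2 :=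
  if n.val = 0 then alignSum q W s.1 (if s.2.val = 0 then 0 else 1)
  else alignSum q W s.1 0 + alignSum q W s.1 1

lemma alignSum_sub (q : Fin Ku → Fin 2 → Fin (N - 1) → ZMod 2)
    (W W' : Fin 2 → AlignPos Ku N t → ZMod 2) (S : UserSet Ku (t + 1)) (k : Fin 2) :
    alignSum q (W - W') S k = alignSum q W S k - alignSum q W' S k := by
  simp only [alignSum, Pi.sub_apply, mul_sub, Finset.sum_sub_distrib]
  ring

/-- If the symbols cached by `u` vanish, then a combination for the set `T ∪ {u}` only involves the
uncached symbol of that set and the symbols of `T`. -/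
lemma alignSum_of_cached_eq_zero (q : Fin Ku → Fin 2 → Fin (N - 1) → ZMod 2)
    (W : Fin 2 → AlignPos Ku N t → ZMod 2) (u : Fin Ku)
    (hW : ∀ k (T : UserSet Ku t) i, u ∈ T.1 → W k (.inl (T, i)) = 0)
    (S : UserSet Ku (t + 1)) (hu : u ∈ S.1) (k : Fin 2) :
    alignSum q W S k = W k (.inr S) + ∑ i, q u k i * W k (.inl (S.erase ⟨u, hu⟩, i)) := by
  rw [alignSum, Finset.sum_eq_single (⟨u, hu⟩ : {v // v ∈ S.1})]
  · intro v _ hv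
    refine Finset.sum_eq_zero fun i _ => ?_
    rw [hW, mul_zero]
    exact Finset.mem_erase.2 ⟨fun h => hv (Subtype.ext h.symm), hu⟩
  · simp

/-- User `u` recovers the wanted message. The answers of database `0` for a set `S ∋ u` contain
the same interference as those of database `i + 1`, and the difference of the two is the `i`-th
wanted symbol for `S \ {u}`; once these are known for all sets, database `0` gives the uncached
symbols, also for the sets that do not contain `u`. -/
lemma align_decode (hN : 0 < N) (θ : Demand 2 Ku) (u : Fin Ku)
    (r : Fin Ku → Fin 2 → Fin (N - 1) → ZMod 2) (W : Fin 2 → AlignPos Ku N t → ZMod 2)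
    (hW : ∀ k (T : UserSet Ku t) i, u ∈ T.1 → W k (.inl (T, i)) = 0)
    (h0 : ∀ S k, alignSum (alignQuery θ r ⟨0, hN⟩) W S k = 0)
    (h1 : ∀ n : Fin N, n.val ≠ 0 → ∀ S,
      alignSum (alignQuery θ r n) W S 0 + alignSum (alignQuery θ r n) W S 1 = 0) :
    W (θ u) = 0 := by
  have hq0 : alignQuery θ r ⟨0, hN⟩ = r := by
    funext v k i
    simp [alignQuery]
  have hcached : ∀ T i, W (θ u) (.inl (T, i)) = 0 := by
    intro T i
    by_cases hu : u ∈ T.1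
    · exact hW _ T i hu
    let S : UserSet Ku (t + 1) := ⟨insert u T.1, by rw [Finset.card_insert_of_notMem hu, T.2]⟩
    have huS : u ∈ S.1 := Finset.mem_insert_self _ _
    have hST : S.erase ⟨u, huS⟩ = T := Subtype.ext (Finset.erase_insert hu)
    let n : Fin N := ⟨i.val + 1, by have := i.2; omega⟩
    -- Passing from database `0` to database `i + 1` changes only the combination of the wanted
    -- message, and by the symbol sought.
    have hdiff : ∀ k, alignSum (alignQuery θ r n) W S k =
        alignSum r W S k + if k = θ u then W k (.inl (T, i)) else 0 := by
      intro k
      rw [alignSum_of_cached_eq_zero _ W u hW S huS, alignSum_of_cached_eq_zero r W u hW S huS, hST,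
        add_assoc]
      congr 1
      simp only [alignQuery, Pi.add_apply, add_mul, Finset.sum_add_distrib, ite_mul, one_mul,
        zero_mul]
      congr 1
      rw [Finset.sum_eq_single i]
      · simp [n]
      · intro j _ hj
        rw [if_neg]
        rintro ⟨-, h⟩
        exact hj (Fin.ext (by simpa [n] using h.symm))
      · simp
    have h := h1 n (by simp [n]) S
    rw [hdiff, hdiff, ← hq0, h0, h0] at h
    generalize θ u = k at h ⊢
    fin_cases k <;> simpa using h
  funext x
  rcases x with ⟨T, i⟩ | S
  · exact hcached T i
  · have h := h0 S (θ u)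
    simpa [alignSum, hcached] using h

/-- The design that aligns, for every set of `t + 1` users, the interference of each of them. -/
def align (Ku N t : ℕ) (hN : 0 < N) : Design 2 Ku N where
  Pos := AlignPos Ku N t
  cached u _ := (Finset.univ.filter fun x : UserSet Ku t × Fin (N - 1) => u ∈ x.1.1).disjSum ∅
  Key := Fin Ku → Fin 2 → Fin (N - 1) → ZMod 2
  Query _ := Fin Ku → Fin 2 → Fin (N - 1) → ZMod 2
  query := alignQuery
  Slot n := UserSet Ku (t + 1) × Fin (if n.val = 0 then 2 else 1)
  answer := alignAnswer
  decode θ u r W W' hc ha := by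
    refine sub_eq_zero.1 (align_decode hN θ u r (W - W') ?_ ?_ ?_)
    · intro k T i hu
      exact sub_eq_zero.2 (hc k _ (Finset.inl_mem_disjSum.2 (by simpa using hu)))
    · intro S k
      have h := congrFun (ha ⟨0, hN⟩) (S, ⟨k.val, by simp; omega⟩)
      rw [alignSum_sub, sub_eq_zero]
      fin_cases k <;> simpa [alignAnswer] using h
    · intro n hn S
      have h := congrFun (ha n) (S, ⟨0, by simp [hn]⟩)
      simp only [alignAnswer, if_neg hn] at h
      rw [alignSum_sub, alignSum_sub, sub_add_sub_comm, h, sub_self]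
  rekey θ θ' n := ⟨Equiv.addRight (alignQuery θ 0 n - alignQuery θ' 0 n), fun r => by
    simp only [alignQuery, Equiv.coe_addRight, zero_add]
    abel⟩

lemma card_filter_mem_userSet (u : Fin Ku) (ht : 0 < t) :
    (Finset.univ.filter fun T : UserSet Ku t => u ∈ T.1).card = (Ku - 1).choose (t - 1) := by
  obtain ⟨t, rfl⟩ : ∃ s, t = s + 1 := ⟨t - 1, by omega⟩
  have hcard : (Finset.univ.erase u).card = Ku - 1 := by simp
  rw [Nat.add_sub_cancel, ← hcard, ← Finset.card_powersetCard]
  have hnot : ∀ T ∈ (Finset.univ.erase u).powersetCard t, u ∉ T := fun T hT h => by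
    simpa using (Finset.mem_powersetCard.1 hT).1 h
  refine (Finset.card_bij (fun T hT => (⟨insert u T, by
    rw [Finset.card_insert_of_notMem (hnot T hT), (Finset.mem_powersetCard.1 hT).2]⟩ :
      UserSet Ku (t + 1))) ?_ ?_ ?_).symm
  · intro T hT
    simp
  · intro T hT T' hT' h
    have h' : insert u T = insert u T' := congrArg Subtype.val h
    rw [← Finset.erase_insert (hnot T hT), ← Finset.erase_insert (hnot T' hT'), h']
  · intro T hT
    have hu : u ∈ T.1 := (Finset.mem_filter.1 hT).2
    refine ⟨T.1.erase u, Finset.mem_powersetCard.2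
      ⟨Finset.erase_subset_erase _ (Finset.subset_univ _), ?_⟩,
      Subtype.ext (Finset.insert_erase hu)⟩
    rw [Finset.card_erase_of_mem hu, T.2, Nat.add_sub_cancel]

lemma exists_align (hN : 0 < N) (ht : 0 < t) :
    Exists 2 Ku N (Ku.choose t * (N - 1) + Ku.choose (t + 1))
      (2 * ((Ku - 1).choose (t - 1) * (N - 1))) (Ku.choose (t + 1) * (N + 1)) := by
  refine ⟨align Ku N t hN, ?_, fun u => ?_, ?_⟩
  · change Fintype.card (AlignPos Ku N t) = _
    simp [Fintype.card_finset_len]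
  · have h : (Finset.univ.filter fun x : UserSet Ku t × Fin (N - 1) => u ∈ x.1.1) =
        (Finset.univ.filter fun T : UserSet Ku t => u ∈ T.1) ×ˢ Finset.univ := by
      ext x
      simp
    simp only [align, h, Finset.card_disjSum, Finset.card_product, card_filter_mem_userSet u ht]
    simp
  · obtain ⟨N, rfl⟩ : ∃ m, N = m + 1 := ⟨N - 1, by omega⟩
    change ∑ n : Fin (N + 1), Fintype.card (UserSet Ku (t + 1) × Fin (if n.val = 0 then 2 else 1)) ≤ _
    simp only [Fintype.card_prod, Fintype.card_finset_len, Fintype.card_fin, ← Finset.mul_sum]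
    rw [Fin.sum_univ_succ]
    simp
    apply le_of_eq
    ring

end Alignment

end Design

/-! ### Memory sharing -/

/-- The memory-load pairs that designs approach, the memory being respected exactly and the load
up to an arbitrarily small excess. -/
def designRegion (Ku N : ℕ) : Set (ℝ × ℝ) :=
  {p | ∀ ε > 0, ∃ L m d : ℕ, 0 < L ∧ Design.Exists 2 Ku N L m d ∧ (m : ℝ) ≤ p.1 * L ∧
    (d : ℝ) ≤ (p.2 + ε) * L}

variable {Ku N : ℕ}

lemma mem_designRegion_of_exists {L m d : ℕ} (hL : 0 < L) (h : Design.Exists 2 Ku N L m d)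
    {p : ℝ × ℝ} (hm : (m : ℝ) ≤ p.1 * L) (hd : (d : ℝ) ≤ p.2 * L) : p ∈ designRegion Ku N :=
  fun ε hε => ⟨L, m, d, hL, h, hm, hd.trans (by gcongr; linarith)⟩

lemma nonneg_of_mem_designRegion {p : ℝ × ℝ} (hp : p ∈ designRegion Ku N) : 0 ≤ p.2 := by
  refine le_of_forall_pos_le_add fun ε hε => ?_
  obtain ⟨L, m, d, hL, -, -, hd⟩ := hp ε hε
  have hL' : (0 : ℝ) < L := by exact_mod_cast hL
  exact nonneg_of_mul_nonneg_left ((Nat.cast_nonneg d).trans hd) hL'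

lemma achievableUncoded_of_mem_designRegion {M R : ℝ} (h : (M, R) ∈ designRegion Ku N) {ε : ℝ}
    (hε : 0 < ε) : AchievableUncoded 2 Ku N M (R + ε) := by
  obtain ⟨L, m, d, hL, hD, hm, hd⟩ := h ε hε
  exact hD.achievableUncoded hL hm hd

/-- Designs for two pairs are repeated in integer proportions close to `a : b` from below. The
bounded number of symbols that rounding leaves over is not cached and downloaded entirely. -/
lemma convex_designRegion (hN : 0 < N) : Convex ℝ (designRegion Ku N) := by
  rintro ⟨M, R⟩ hp ⟨M', R'⟩ hp' a b ha hb hab ε hε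
  have hR : 0 ≤ R := nonneg_of_mem_designRegion hp
  have hR' : 0 ≤ R' := nonneg_of_mem_designRegion hp'
  obtain ⟨L, m, d, hL, hD, hm, hd⟩ := hp (ε / 2) (half_pos hε)
  obtain ⟨L', m', d', hL', hD', hm', hd'⟩ := hp' (ε / 2) (half_pos hε)
  dsimp only at hm hd hm' hd'
  have hL0 : (0 : ℝ) < L := by exact_mod_cast hL
  have hL0' : (0 : ℝ) < L' := by exact_mod_cast hL'
  have hM : 0 ≤ M := nonneg_of_mul_nonneg_left ((Nat.cast_nonneg m).trans hm) hL0
  have hM' : 0 ≤ M' := nonneg_of_mul_nonneg_left ((Nat.cast_nonneg m').trans hm') hL0'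
  -- For such `n` the at most `L + L'` leftover symbols, two bits of download each, cost at most
  -- half of `ε` per symbol of the `n L L'` ones.
  obtain ⟨n, hn⟩ := exists_nat_gt (4 * ((L : ℝ) + L') / (ε * (L * L')))
  rw [div_lt_iff₀ (by positivity)] at hn
  have hn0 : (0 : ℝ) < n := by
    refine pos_of_mul_pos_left (lt_trans (by positivity) hn) (by positivity)
  set i := ⌊a * n * L'⌋₊
  set j := ⌊b * n * L⌋₊
  have hi : (i : ℝ) ≤ a * n * L' := Nat.floor_le (by positivity)
  have hi' : a * n * L' < i + 1 := Nat.lt_floor_add_one _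
  have hj : (j : ℝ) ≤ b * n * L := Nat.floor_le (by positivity)
  have hj' : b * n * L < j + 1 := Nat.lt_floor_add_one _
  have hiL := mul_le_mul_of_nonneg_right hi hL0.le
  have hjL := mul_le_mul_of_nonneg_right hj hL0'.le
  have htot : a * n * L' * L + b * n * L * L' = n * (L * L') := by
    rw [← one_mul ((n : ℝ) * (L * L')), ← hab]
    ring
  have hle : i * L + j * L' ≤ n * (L * L') := by
    have : (i : ℝ) * L + j * L' ≤ n * (L * L') := by linarith
    exact_mod_cast this
  obtain ⟨k, hk⟩ := Nat.exists_eq_add_of_le hle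
  have hkR : (n : ℝ) * (L * L') = i * L + j * L' + k := by exact_mod_cast hk
  have hkle : (k : ℝ) ≤ L + L' := by
    nlinarith [mul_le_mul_of_nonneg_right hi'.le hL0.le, mul_le_mul_of_nonneg_right hj'.le hL0'.le]
  refine ⟨n * (L * L'), i * m + j * m', i * d + j * d' + k * 2, ?_, ?_, ?_, ?_⟩
  · have : 0 < n := by exact_mod_cast hn0
    positivity
  · rw [hk]
    simpa using ((hD.smul i).append (hD'.smul j)).append ((Design.exists_download_all hN).smul k)
  · have h1 := mul_le_mul_of_nonneg_left hm (Nat.cast_nonneg (α := ℝ) i)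
    have h2 := mul_le_mul_of_nonneg_left hm' (Nat.cast_nonneg (α := ℝ) j)
    have h3 := mul_le_mul_of_nonneg_left hiL hM
    have h4 := mul_le_mul_of_nonneg_left hjL hM'
    push_cast
    simp only [Prod.smul_mk, Prod.mk_add_mk, smul_eq_mul]
    linarith
  · have h1 := mul_le_mul_of_nonneg_left hd (Nat.cast_nonneg (α := ℝ) i)
    have h2 := mul_le_mul_of_nonneg_left hd' (Nat.cast_nonneg (α := ℝ) j)
    have h3 := mul_le_mul_of_nonneg_left hiL (add_nonneg hR (half_pos hε).le)
    have h4 := mul_le_mul_of_nonneg_left hjL (add_nonneg hR' (half_pos hε).le)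
    have h5 : (ε / 2) * (n * (L * L')) = (ε / 2) * (a * n * L' * L + b * n * L * L') := by
      rw [htot]
    push_cast
    simp only [Prod.smul_mk, Prod.mk_add_mk, smul_eq_mul]
    linarith

/-! ### The region of the proposed scheme -/

/-- The memory-load pairs whose lower convex envelope is the proposed load. -/
def proposedPoints (Ku N : ℕ) : Set (ℝ × ℝ) :=
  {(0, 2), (2, 0)} ∪
    (fun t : ℕ => (proposedMemory Ku N t, proposedPointLoad Ku N t)) '' Set.Icc 1 (Ku - 1)

lemma timeSharing_mem_hull {M : ℝ} (hM : M ∈ Set.Icc (0 : ℝ) 2) :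
    (M, 2 - M) ∈ convexHull ℝ ({(0, 2), (2, 0)} : Set (ℝ × ℝ)) := by
  rw [convexHull_pair]
  refine ⟨1 - M / 2, M / 2, by linarith [hM.2], by linarith [hM.1], by ring, ?_⟩
  ext <;> simp; ring

lemma timeSharing_mem_proposedHull {M : ℝ} (hM : M ∈ Set.Icc (0 : ℝ) 2) :
    (M, 2 - M) ∈ convexHull ℝ (proposedPoints Ku N) :=
  convexHull_mono Set.subset_union_left (timeSharing_mem_hull hM)

/-- The ratio `C(Ku, t + 1) / C(Ku, t) = (Ku - t) / (t + 1)`. -/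
noncomputable def chooseRatio (Ku t : ℕ) : ℝ := ((Ku : ℝ) - t) / (t + 1)

lemma choose_succ_eq {t : ℕ} (ht : t ≤ Ku) :
    (Ku.choose (t + 1) : ℝ) = Ku.choose t * chooseRatio Ku t := by
  have h := Nat.choose_succ_right_eq Ku t
  have h' : (Ku.choose (t + 1) : ℝ) * (t + 1) = Ku.choose t * (Ku - t) := by
    rw [← Nat.cast_sub ht]
    exact_mod_cast h
  rw [chooseRatio]
  field_simp
  linarith

lemma choose_pred_eq {t : ℕ} (hKu : 0 < Ku) (ht : 0 < t) :
    ((Ku - 1).choose (t - 1) : ℝ) = Ku.choose t * (t / Ku) := by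
  obtain ⟨Ku, rfl⟩ : ∃ s, Ku = s + 1 := ⟨Ku - 1, by omega⟩
  obtain ⟨t, rfl⟩ : ∃ s, t = s + 1 := ⟨t - 1, by omega⟩
  have h := Nat.add_one_mul_choose_eq Ku t
  have h' : ((Ku : ℝ) + 1) * Ku.choose t = (Ku + 1).choose (t + 1) * (t + 1) := by exact_mod_cast h
  simp only [Nat.add_sub_cancel]
  push_cast
  field_simp
  linarith

lemma chooseRatio_pos {t : ℕ} (ht : t < Ku) : 0 < chooseRatio Ku t := by
  have : (t : ℝ) < Ku := by exact_mod_cast ht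
  rw [chooseRatio]
  exact div_pos (by linarith) (by positivity)

lemma messageSize_eq {t : ℕ} (ht : t ≤ Ku) :
    messageSize Ku N t = Ku.choose t * ((N : ℝ) - 1 + chooseRatio Ku t) := by
  rw [messageSize, choose_succ_eq ht]
  ring

lemma proposedMemory_eq {t : ℕ} (ht : 0 < t) (htKu : t ≤ Ku) :
    proposedMemory Ku N t = productMemory Ku t * ((N - 1) / (N - 1 + chooseRatio Ku t)) := by
  have hc : (Ku.choose t : ℝ) ≠ 0 := by exact_mod_cast (Nat.choose_pos htKu).ne'
  rw [proposedMemory, messageSize_eq htKu, choose_pred_eq (by omega) ht, productMemory,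
    show 2 * ((Ku.choose t : ℝ) * (t / Ku)) * ((N : ℝ) - 1) =
      Ku.choose t * (t * 2 / Ku * (N - 1)) by ring, mul_div_mul_left _ _ hc, mul_div_assoc]

lemma proposedPointLoad_eq {t : ℕ} (htKu : t ≤ Ku) :
    proposedPointLoad Ku N t =
      min (chooseRatio Ku t * (N + 1) / (N - 1 + chooseRatio Ku t)) (2 - proposedMemory Ku N t) := by
  have hc : (Ku.choose t : ℝ) ≠ 0 := by exact_mod_cast (Nat.choose_pos htKu).ne'
  rw [proposedPointLoad, messageSize_eq htKu, choose_succ_eq htKu, mul_assoc,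
    mul_div_mul_left _ _ hc]

lemma productMemory_mem_Icc {t : ℕ} (htKu : t ≤ Ku) : productMemory Ku t ∈ Set.Icc (0 : ℝ) 2 := by
  have h : (t : ℝ) ≤ Ku := by exact_mod_cast htKu
  exact ⟨by rw [productMemory]; positivity, div_le_of_le_mul₀ (by positivity) (by norm_num)
    (by linarith)⟩

lemma proposedMemory_mem_Icc {t : ℕ} (hN : 2 ≤ N) (ht : 0 < t) (htKu : t < Ku) :
    proposedMemory Ku N t ∈ Set.Icc (0 : ℝ) (productMemory Ku t) := by
  have hN' : (2 : ℝ) ≤ N := by exact_mod_cast hN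
  have hr := chooseRatio_pos htKu
  have hm := (productMemory_mem_Icc htKu.le).1
  rw [proposedMemory_eq ht htKu.le]
  exact ⟨mul_nonneg hm (div_nonneg (by linarith) (by linarith)),
    mul_le_of_le_one_right hm ((div_le_one (by linarith)).2 (by linarith))⟩

lemma timeSharing_mem_designRegion (hN : 0 < N) {M : ℝ} (hM : M ∈ Set.Icc (0 : ℝ) 2) :
    (M, 2 - M) ∈ designRegion Ku N := by
  refine convexHull_min ?_ (convex_designRegion hN) (timeSharing_mem_hull hM)
  rintro p (rfl | rfl)
  · exact mem_designRegion_of_exists one_pos (Design.exists_download_all hN) (by simp) (by simp)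
  · exact mem_designRegion_of_exists one_pos Design.exists_cache_all (by simp) (by simp)

lemma convexHull_proposedPoints_subset (hN : 2 ≤ N) :
    convexHull ℝ (proposedPoints Ku N) ⊆ designRegion Ku N := by
  have hN0 : 0 < N := by omega
  have hN' : (2 : ℝ) ≤ N := by exact_mod_cast hN
  refine convexHull_min ?_ (convex_designRegion hN0)
  rintro p ((rfl | rfl) | ⟨t, ⟨ht, htKu⟩, rfl⟩)
  · simpa using timeSharing_mem_designRegion (Ku := Ku) hN0 (M := 0) (by norm_num)
  · simpa using timeSharing_mem_designRegion (Ku := Ku) hN0 (M := 2) (by norm_num)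
  · have htKu' : t < Ku := by omega
    have hmem := proposedMemory_mem_Icc hN ht htKu'
    dsimp only
    rcases min_choice ((Ku.choose (t + 1) : ℝ) * ((N : ℝ) + 1) / messageSize Ku N t)
      (2 - proposedMemory Ku N t) with h | h
    · rw [proposedPointLoad, h]
      have hpos : 0 < Ku.choose t * (N - 1) + Ku.choose (t + 1) :=
        Nat.add_pos_right _ (Nat.choose_pos htKu')
      have hsize : ((Ku.choose t * (N - 1) + Ku.choose (t + 1) : ℕ) : ℝ) = messageSize Ku N t := by
        rw [messageSize]
        push_cast [Nat.cast_sub (show 1 ≤ N by omega)]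
        ring
      have hne : messageSize Ku N t ≠ 0 := by
        rw [← hsize]
        exact_mod_cast hpos.ne'
      refine mem_designRegion_of_exists hpos (Design.exists_align hN0 ht) (le_of_eq ?_)
        (le_of_eq ?_)
      · rw [hsize, proposedMemory, div_mul_cancel₀ _ hne]
        push_cast [Nat.cast_sub (show 1 ≤ N by omega)]
        ring
      · rw [hsize, div_mul_cancel₀ _ hne]
        push_cast
        ring
    · rw [proposedPointLoad, h]
      exact timeSharing_mem_designRegion hN0
        ⟨hmem.1, hmem.2.trans (productMemory_mem_Icc htKu'.le).2⟩

lemma bddBelow_proposedHull (hN : 2 ≤ N) (M : ℝ) :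
    BddBelow {R : ℝ | (M, R) ∈ convexHull ℝ (proposedPoints Ku N)} :=
  ⟨0, fun _ hR => nonneg_of_mem_designRegion (convexHull_proposedPoints_subset hN hR)⟩

lemma proposedLoad_nonneg (hN : 2 ≤ N) (M : ℝ) : 0 ≤ proposedLoad Ku N M :=
  Real.sInf_nonneg fun _ hR =>
    nonneg_of_mem_designRegion (convexHull_proposedPoints_subset hN hR)

/-! ### Comparison with the product design -/

/-- The points on or above the convex hull of a set of memory-load pairs. -/
def upperHull (P : Set (ℝ × ℝ)) : Set (ℝ × ℝ) := {p | ∃ R ≤ p.2, (p.1, R) ∈ convexHull ℝ P}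

lemma convex_upperHull (P : Set (ℝ × ℝ)) : Convex ℝ (upperHull P) := by
  rintro ⟨M, R⟩ ⟨r, hr, h⟩ ⟨M', R'⟩ ⟨r', hr', h'⟩ a b ha hb hab
  refine ⟨a * r + b * r', ?_, ?_⟩
  · exact add_le_add (mul_le_mul_of_nonneg_left hr ha) (mul_le_mul_of_nonneg_left hr' hb)
  · simpa using convex_convexHull ℝ P h h' ha hb hab

/-- The pair of the product design with parameter `t < Ku` lies above the segment from
`(M_t, R_t)` to `(2, 0)`: this amounts to `(Ku - t) / (t + 1) + t / Ku ≥ 1`. -/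
lemma productPoint_mem_upperHull (hN : 2 ≤ N) {t : ℕ} (ht : 0 < t) (htKu : t < Ku) :
    (productMemory Ku t, chooseRatio Ku t * (1 + 1 / (N : ℝ))) ∈
      upperHull (proposedPoints Ku N) := by
  have hN' : (2 : ℝ) ≤ N := by exact_mod_cast hN
  have ht0 : (0 : ℝ) < t := by exact_mod_cast ht
  have htKu' : (t : ℝ) + 1 ≤ Ku := by exact_mod_cast htKu
  have hK0 : (0 : ℝ) < Ku := by linarith
  have hr := chooseRatio_pos htKu
  have hM := proposedMemory_mem_Icc hN ht htKu
  have hprod : productMemory Ku t < 2 := by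
    rw [productMemory, div_lt_iff₀ hK0]
    linarith
  have hkey : 1 ≤ chooseRatio Ku t + productMemory Ku t / 2 := by
    have h1 : chooseRatio Ku t + productMemory Ku t / 2 - 1 =
        (Ku - t) * (Ku - (t + 1)) / ((t + 1) * Ku) := by
      rw [chooseRatio, productMemory]
      field_simp
      ring
    have h2 : 0 ≤ ((Ku : ℝ) - t) * (Ku - (t + 1)) / ((t + 1) * Ku) :=
      div_nonneg (mul_nonneg (by linarith) (by linarith)) (by positivity)
    linarith
  have hMeq := proposedMemory_eq (N := N) ht htKu.le
  have hload : proposedPointLoad Ku N t ≤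
      chooseRatio Ku t * (N + 1) / (N - 1 + chooseRatio Ku t) := by
    rw [proposedPointLoad_eq htKu.le]
    exact min_le_left _ _
  have hpoint : (proposedMemory Ku N t, proposedPointLoad Ku N t) ∈
      convexHull ℝ (proposedPoints Ku N) :=
    subset_convexHull ℝ _ (Or.inr ⟨t, ⟨ht, by omega⟩, rfl⟩)
  have hend : ((2 : ℝ), (0 : ℝ)) ∈ convexHull ℝ (proposedPoints Ku N) :=
    subset_convexHull ℝ _ (Or.inl (Or.inr rfl))
  generalize proposedMemory Ku N t = m at *
  generalize proposedPointLoad Ku N t = l at *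
  generalize productMemory Ku t = p at *
  generalize chooseRatio Ku t = r at *
  have hm2 : 0 < 2 - m := by linarith [hM.2]
  have hweight : (2 - p) / (2 - m) ≤ 1 := (div_le_one hm2).2 (by linarith [hM.2])
  have hweight0 : 0 ≤ (2 - p) / (2 - m) := div_nonneg (by linarith) hm2.le
  refine ⟨(2 - p) / (2 - m) * l, ?_, ?_⟩
  · have hs : 0 < (N : ℝ) - 1 + r := by linarith
    have hms : (2 - m) * (N - 1 + r) = 2 * (N - 1 + r) - p * (N - 1) := by
      rw [hMeq]
      field_simp
    calc (2 - p) / (2 - m) * l ≤ (2 - p) / (2 - m) * (r * (N + 1) / (N - 1 + r)) :=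
          mul_le_mul_of_nonneg_left hload hweight0
      _ = r * (N + 1) * ((2 - p) / ((2 - m) * (N - 1 + r))) := by
          field_simp
      _ ≤ r * (N + 1) * (1 / N) := by
          refine mul_le_mul_of_nonneg_left ?_ (by positivity)
          rw [div_le_div_iff₀ (mul_pos hm2 hs) (by linarith), hms]
          linarith
      _ = r * (1 + 1 / N) := by
          field_simp
  · have h := convex_convexHull ℝ _ hpoint hend hweight0 (sub_nonneg.2 hweight) (by ring)
    convert h using 1
    ext
    · simp
      field_simp
      ring
    · simp

lemma proposedLoad_le_productDesignLoad (hKu : 2 ≤ Ku) (hN : 2 ≤ N) {M : ℝ}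
    (hM : M ∈ Set.Icc (0 : ℝ) 2) : proposedLoad Ku N M ≤ productDesignLoad Ku N M := by
  set P : Set (ℝ × ℝ) := {(0, 2)} ∪
    (fun t : ℕ => (productMemory Ku t, productPointLoad Ku N t)) '' Set.Icc 1 Ku with hP
  have hK0 : (Ku : ℝ) ≠ 0 := by
    have : Ku ≠ 0 := by omega
    exact_mod_cast this
  have hlast : productMemory Ku Ku = 2 := by
    rw [productMemory]
    field_simp
  have hnonempty : {R : ℝ | (M, R) ∈ convexHull ℝ P}.Nonempty := by
    refine ⟨2 - M, convexHull_mono ?_ (timeSharing_mem_hull hM)⟩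
    rintro p (rfl | rfl)
    · exact Or.inl rfl
    · refine Or.inr ⟨Ku, ⟨by omega, le_rfl⟩, ?_⟩
      simp [hlast, productPointLoad]
  have hsub : convexHull ℝ P ⊆ upperHull (proposedPoints Ku N) := by
    refine convexHull_min ?_ (convex_upperHull _)
    rintro p (rfl | ⟨t, ⟨ht, htKu⟩, rfl⟩)
    · exact ⟨2, le_rfl, subset_convexHull ℝ _ (Or.inl (Or.inl rfl))⟩
    · have hshare : (productMemory Ku t, 2 - productMemory Ku t) ∈
          upperHull (proposedPoints Ku N) :=
        ⟨_, le_rfl, timeSharing_mem_proposedHull (productMemory_mem_Icc htKu)⟩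
      dsimp only
      rw [productPointLoad]
      rcases min_choice (((Ku : ℝ) - t) / ((t : ℝ) + 1) * (1 + 1 / (N : ℝ)))
        (2 - productMemory Ku t) with h | h
      · rcases htKu.lt_or_eq with hlt | rfl
        · rw [h]
          exact productPoint_mem_upperHull hN ht hlt
        · simpa [hlast] using hshare
      · rw [h]
        exact hshare
  refine le_csInf hnonempty fun R hR => ?_
  obtain ⟨R', hle, hR'⟩ := hsub hR
  exact (csInf_le (bddBelow_proposedHull hN M) hR').trans hle

/-! ### Comparison with the optimal loads -/

lemma AchievableUncoded.achievable {K : ℕ} {M R : ℝ} (h : AchievableUncoded K Ku N M R) :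
    Achievable K Ku N M R := by
  obtain ⟨L, hL, S, -, hS⟩ := h
  exact ⟨L, hL, S, hS⟩

lemma Achievable.load_ge (hKu : 0 < Ku) {M R : ℝ} (h : Achievable 2 Ku N M R) :
    1 - M / 2 ≤ R := by
  obtain ⟨L, hL, S, hS⟩ := h
  exact S.load_ge hKu hL hS

lemma achievableUncoded_of_mem_proposedHull (hN : 2 ≤ N) {M R ε : ℝ}
    (hR : (M, R) ∈ convexHull ℝ (proposedPoints Ku N)) (hε : 0 < ε) :
    AchievableUncoded 2 Ku N M (R + ε) :=
  achievableUncoded_of_mem_designRegion (convexHull_proposedPoints_subset hN hR) hε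

lemma proposedLoad_le_timeSharing (hN : 2 ≤ N) {M : ℝ} (hM : M ∈ Set.Icc (0 : ℝ) 2) :
    proposedLoad Ku N M ≤ 2 - M :=
  csInf_le (bddBelow_proposedHull hN M) (timeSharing_mem_proposedHull hM)

/-- Any class of achievable loads that contains those approached by designs has an infimum between
the proposed load and half of it. -/
lemma sInf_load_bounds (hKu : 2 ≤ Ku) (hN : 2 ≤ N) {M : ℝ} (hM : M ∈ Set.Icc (0 : ℝ) 2)
    (T : Set ℝ) (hT : ∀ R ∈ T, Achievable 2 Ku N M R)
    (hT' : ∀ R, AchievableUncoded 2 Ku N M R → R ∈ T) :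
    sInf T ≤ proposedLoad Ku N M ∧ proposedLoad Ku N M ≤ 2 * sInf T := by
  have hlower : ∀ R ∈ T, 1 - M / 2 ≤ R := fun R hR => (hT R hR).load_ge (by omega)
  have hshare : (M, 2 - M) ∈ convexHull ℝ (proposedPoints Ku N) := timeSharing_mem_proposedHull hM
  constructor
  · refine le_csInf ⟨_, hshare⟩ fun R hR => le_of_forall_pos_le_add fun ε hε => ?_
    exact csInf_le ⟨_, hlower⟩ (hT' _ (achievableUncoded_of_mem_proposedHull hN hR hε))
  · have h : 1 - M / 2 ≤ sInf T :=
      le_csInf ⟨_, hT' _ (achievableUncoded_of_mem_proposedHull hN hshare one_pos)⟩ hlower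
    linarith [proposedLoad_le_timeSharing (Ku := Ku) hN hM]

end MuPIR

theorem corollary1 (Ku N : ℕ) (hKu : 2 ≤ Ku) (hN : 2 ≤ N) (M : ℝ) (hM : M ∈ Set.Icc (0 : ℝ) 2) :
    MuPIR.proposedLoad Ku N M ≤ MuPIR.productDesignLoad Ku N M ∧
    (MuPIR.optimalLoad 2 Ku N M ≤ MuPIR.proposedLoad Ku N M ∧
      MuPIR.proposedLoad Ku N M ≤ 8 * MuPIR.optimalLoad 2 Ku N M) ∧
    (MuPIR.optimalLoadUncoded 2 Ku N M ≤ MuPIR.proposedLoad Ku N M ∧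
      MuPIR.proposedLoad Ku N M ≤ 8 * MuPIR.optimalLoadUncoded 2 Ku N M) := by
  have h := MuPIR.sInf_load_bounds hKu hN hM {R | MuPIR.Achievable 2 Ku N M R} (fun _ hR => hR)
    fun _ hR => hR.achievable
  have hunc := MuPIR.sInf_load_bounds hKu hN hM {R | MuPIR.AchievableUncoded 2 Ku N M R}
    (fun _ hR => hR.achievable) fun _ hR => hR
  have h0 := MuPIR.proposedLoad_nonneg (Ku := Ku) hN M
  refine ⟨MuPIR.proposedLoad_le_productDesignLoad hKu hN hM, ⟨h.1, ?_⟩, hunc.1, ?_⟩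
  · change _ ≤ 8 * sInf _
    linarith [h.2]
  · change _ ≤ 8 * sInf _
    linarith [hunc.2]
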